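/- Let $K$ be a field, $S=K[x_1,\dots,x_n]$, and let $I\subseteq S$ be a monomial ideal. Let $G(I)$ be the minimal set of monomial generators of $I$, let $\deg(I)$ be the highest degree of a monomial in $G(I)$, and let $m(I)=\max_{u\in G(I)} m(u)$, where $m(u)=\max\{i : x_i\mid u\}$ for a monomial $u\neq 1$ and $m(1)=0$ (for $I=0$ put $\deg(I)=m(I)=0$). Let $\beta_{ij}(I)$ be the graded Betti numbers of $I$, i.e. the number of basis elements of degree $j$ in homological degree $i$ of a minimal graded free resolution of $I$ over $S$, and let $\operatorname{reg}(I)=\max\{j-i : \beta_{ij}(I)\neq 0\}$ (with $\operatorname{reg}(0)=-\infty$). If the set $\operatorname{Ass}(S/I)$ of associated primes of $S/I$ is totally ordered by inclusion, then $$\operatorname{reg}(I)\le m(I)\,(\deg(I)-1)+1 .$$ Moreover, after a suitable permutation of the variables $I$ becomes an ideal of Borel type, that is, there is a permutation $\sigma$ of $\{1,\dots,n\}$ such that the image $I'$ of $I$ under $x_i\mapsto x_{\sigma(i)}$ satisfies $(I':x_j^\infty)=(I':(x_1,\dots,x_j)^\infty)$ for all $j=1,\dots,n$. -/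

import Mathlib

open MvPolynomial

namespace BorelReg

noncomputable section

/-- `I` is a monomial ideal: it is generated by a set of monomials (given by exponent vectors). -/
def IsMonomialIdeal {K : Type*} [Field K] {n : ℕ} (I : Ideal (MvPolynomial (Fin n) K)) : Prop :=
  ∃ A : Set (Fin n →₀ ℕ), I = Ideal.span ((fun a => (monomial a (1 : K))) '' A)

/-- The exponent vectors of the minimal monomial generators `G(I)`: the monomials of `I` that are
minimal for divisibility among the monomials of `I`. -/
def minGens {K : Type*} [Field K] {n : ℕ} (I : Ideal (MvPolynomial (Fin n) K)) :
    Set (Fin n →₀ ℕ) :=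
  {a | Minimal (fun b : Fin n →₀ ℕ => monomial b (1 : K) ∈ I) a}

theorem minGens_finite {K : Type*} [Field K] {n : ℕ} (I : Ideal (MvPolynomial (Fin n) K)) :
    (minGens I).Finite :=
  (setOfPred_minimal_antichain _).finite_of_partiallyWellOrderedOn
    (Set.isPWO_of_wellQuasiOrderedLE _)

/-- `deg(I)`: the highest degree of a minimal monomial generator. -/
def genDeg {K : Type*} [Field K] {n : ℕ} (I : Ideal (MvPolynomial (Fin n) K)) : ℕ :=
  (minGens_finite I).toFinset.sup fun a => a.degree

/-- `m(u)` for the monomial `u` with exponent vector `a`: the largest position (counted from `1`)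
of a variable dividing `u`, and `0` for `u = 1`. -/
def maxVar {n : ℕ} (a : Fin n →₀ ℕ) : ℕ :=
  a.support.sup fun i => (i : ℕ) + 1

/-- `m(I)`: the maximum of `m(u)` over the minimal monomial generators `u` of `I`. -/
def maxVarIdeal {K : Type*} [Field K] {n : ℕ} (I : Ideal (MvPolynomial (Fin n) K)) : ℕ :=
  (minGens_finite I).toFinset.sup maxVar

/-- A minimal graded free resolution
`⋯ → F₁ → F₀ → I → 0` with `Fᵢ = ⨁_b S(-deg i b)`, `b` running over a basis of size `rank i`.
The maps are homogeneous of degree `0`: in each entry of the matrix of a map, only monomials occur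
whose degree is the difference of the degrees of the two basis elements. -/
structure MinGradedFreeRes {K : Type*} [Field K] {n : ℕ}
    (I : Ideal (MvPolynomial (Fin n) K)) where
  rank : ℕ → ℕ
  deg : (i : ℕ) → Fin (rank i) → ℕ
  diff : (i : ℕ) → (Fin (rank (i + 1)) → MvPolynomial (Fin n) K) →ₗ[MvPolynomial (Fin n) K]
    (Fin (rank i) → MvPolynomial (Fin n) K)
  aug : (Fin (rank 0) → MvPolynomial (Fin n) K) →ₗ[MvPolynomial (Fin n) K] MvPolynomial (Fin n) K
  diff_homogeneous : ∀ (i : ℕ) (b : Fin (rank (i + 1))) (c : Fin (rank i)),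
    ∀ a ∈ (diff i (Pi.single b 1) c).support, deg i c + a.degree = deg (i + 1) b
  aug_homogeneous : ∀ b : Fin (rank 0), ∀ a ∈ (aug (Pi.single b 1)).support, a.degree = deg 0 b
  range_aug : LinearMap.range aug = I
  exact_aug : Function.Exact (diff 0) aug
  exact_diff : ∀ i : ℕ, Function.Exact (diff (i + 1)) (diff i)
  minimal : ∀ (i : ℕ) (v : Fin (rank (i + 1)) → MvPolynomial (Fin n) K) (c : Fin (rank i)),
    diff i v c ∈ Ideal.span (Set.range (X : Fin n → MvPolynomial (Fin n) K))

open Classical in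
/-- The graded Betti number `β_{ij}(I)`: the number of basis elements of degree `j` in homological
degree `i` of a minimal graded free resolution of `I`. Such a resolution exists and is unique up to
isomorphism for every homogeneous ideal, in particular for every monomial ideal. -/
def gradedBetti {K : Type*} [Field K] {n : ℕ} (I : Ideal (MvPolynomial (Fin n) K))
    (i j : ℕ) : ℕ :=
  if h : Nonempty (MinGradedFreeRes I) then
    (Finset.univ.filter fun b => h.some.deg i b = j).card
  else 0

/-- The regularity `max {j - i | β_{ij}(I) ≠ 0}`, as a supremum in `ℤ ∪ {±∞}`
(so it is `-∞` for the zero ideal). -/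
def regularity {K : Type*} [Field K] {n : ℕ} (I : Ideal (MvPolynomial (Fin n) K)) :
    WithBot (WithTop ℤ) :=
  sSup {r | ∃ i j : ℕ, gradedBetti I i j ≠ 0 ∧ r = (((j : ℤ) - (i : ℤ) : ℤ) : WithTop ℤ)}

/-- The saturation `(I : J^∞) = ⋃ₖ (I : J^k)`; the union is increasing, hence equal to the
supremum. -/
def saturation {R : Type*} [CommRing R] (I J : Ideal R) : Ideal R :=
  ⨆ k : ℕ, Submodule.colon I ((J ^ k : Ideal R) : Set R)

/-- `I` is of Borel type: `(I : x_j^∞) = (I : (x_1, …, x_j)^∞)` for all `j`. -/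
def IsBorelType {K : Type*} [Field K] {n : ℕ} (I : Ideal (MvPolynomial (Fin n) K)) : Prop :=
  ∀ j : Fin n,
    saturation I (Ideal.span {X j}) =
      saturation I (Ideal.span ((fun i => (X i : MvPolynomial (Fin n) K)) '' {i | i ≤ j}))

end

end BorelReg

namespace BorelReg

noncomputable section

/-! Call `x_i` below `x_j` if every associated prime of `S/I` containing `x_j` contains `x_i`. A
chain of primes makes this preorder total, so the variables can be sorted. Since the radical of `I :
f` is an intersection of associated primes, the sorted ideal is of Borel type.

For the regularity, take the variables from the last in this order to the first. If a monomial `u`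
is outside `I` + (earlier variables) but `x_i u` is inside, then `u` involves only `x_i` and later
variables, and a power of each of these moves `u` into `I`. So each exponent is at most `deg(I) -
1`, at most `m(I)` variables are involved, and `deg u ≤ m(I)(deg(I) - 1)`
(`IsMonomialIdeal.almostRegularFrom`). Thus the variables are almost regular on `S/I` from degree `q
= m(I)(deg(I) - 1) + 1` on. Passing to syzygies raises `q` by one (`AlmostRegularFrom.ker`) and
bounds the generators (`degree_le_of_almostRegularFrom`), so induction along the resolution gives
degrees at most `q + i` in step `i`. -/

variable {K : Type*} [Field K] {n : ℕ} {ι κ : Type*}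

/-! ### Graded free modules -/

/-- `v` is homogeneous of degree `e` in the graded free module `⨁_b S(-d b)`. -/
def IsHomogeneousVec (d : ι → ℕ) (e : ℕ) (v : ι → MvPolynomial (Fin n) K) : Prop :=
  ∀ b, ∀ a ∈ (v b).support, d b + a.degree = e

/-- The homogeneous component of degree `e` in the graded free module `⨁_b S(-d b)`. -/
def gradedComp (d : ι → ℕ) (e : ℕ) :
    (ι → MvPolynomial (Fin n) K) →ₗ[K] (ι → MvPolynomial (Fin n) K) :=
  LinearMap.pi fun b =>
    -- For `d b > e` the truncated difference would be `0` and would wrongly select constants.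
    (if d b ≤ e then homogeneousComponent (e - d b) else 0) ∘ₗ LinearMap.proj b

theorem coeff_gradedComp (d : ι → ℕ) (e : ℕ) (v : ι → MvPolynomial (Fin n) K) (b : ι)
    (a : Fin n →₀ ℕ) :
    coeff a (gradedComp d e v b) = if d b + a.degree = e then coeff a (v b) else 0 := by
  simp only [gradedComp, LinearMap.pi_apply, LinearMap.comp_apply, LinearMap.proj_apply]
  by_cases h : d b ≤ e
  · rw [if_pos h, coeff_homogeneousComponent]
    congr 1
    simp only [eq_iff_iff]
    omega
  · rw [if_neg h, if_neg (by omega)]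
    simp

theorem isHomogeneousVec_gradedComp (d : ι → ℕ) (e : ℕ) (v : ι → MvPolynomial (Fin n) K) :
    IsHomogeneousVec d e (gradedComp d e v) := by
  intro b a ha
  rw [mem_support_iff, coeff_gradedComp] at ha
  by_contra h
  simp [h] at ha

theorem IsHomogeneousVec.gradedComp_of_eq {d : ι → ℕ} {e : ℕ} {v : ι → MvPolynomial (Fin n) K}
    (hv : IsHomogeneousVec d e v) : gradedComp d e v = v := by
  ext b a
  rw [coeff_gradedComp]
  split_ifs with h
  · rfl
  · by_contra h0
    exact h (hv b a (mem_support_iff.2 (Ne.symm h0)))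

theorem IsHomogeneousVec.gradedComp_of_ne {d : ι → ℕ} {e e' : ℕ}
    {v : ι → MvPolynomial (Fin n) K} (hv : IsHomogeneousVec d e v) (hne : e ≠ e') :
    gradedComp d e' v = 0 := by
  ext b a
  rw [coeff_gradedComp]
  split_ifs with h
  · by_contra h0
    exact hne ((hv b a (mem_support_iff.2 h0)).symm.trans h)
  · simp

theorem gradedComp_X_smul (d : ι → ℕ) (e : ℕ) (i : Fin n) (v : ι → MvPolynomial (Fin n) K) :
    gradedComp d (e + 1) ((X i : MvPolynomial (Fin n) K) • v) =
      (X i : MvPolynomial (Fin n) K) • gradedComp d e v := by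
  classical
  ext b a
  simp only [coeff_gradedComp, Pi.smul_apply, smul_eq_mul, coeff_X_mul']
  by_cases hi : i ∈ a.support
  · have hle : Finsupp.single i 1 ≤ a := by
      rw [Finsupp.single_le_iff]
      exact Nat.one_le_iff_ne_zero.2 (Finsupp.mem_support_iff.1 hi)
    have hdeg : a.degree = (a - Finsupp.single i 1).degree + 1 := by
      conv_lhs => rw [← tsub_add_cancel_of_le hle]
      simp
    simp only [hi, if_true, hdeg]
    congr 1
    simp only [eq_iff_iff]
    omega
  · simp [hi]

/-! ### Submodules generated by variables -/

/-- The elements of the free module all of whose coordinates lie in the ideal generated by the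
variables in `T`. -/
def varsSubmodule (ι : Type*) (T : Set (Fin n)) :
    Submodule (MvPolynomial (Fin n) K) (ι → MvPolynomial (Fin n) K) :=
  Submodule.pi Set.univ fun _ => Ideal.span (X '' T : Set (MvPolynomial (Fin n) K))

theorem mem_varsSubmodule {T : Set (Fin n)} {v : ι → MvPolynomial (Fin n) K} :
    v ∈ varsSubmodule ι T ↔ ∀ b, ∀ a ∈ (v b).support, ∃ i ∈ T, a i ≠ 0 := by
  simp only [varsSubmodule, Submodule.mem_pi, Set.mem_univ, true_implies]
  exact forall_congr' fun b => mem_ideal_span_X_image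

theorem varsSubmodule_mono {T T' : Set (Fin n)} (h : T ⊆ T') :
    (varsSubmodule ι T : Submodule (MvPolynomial (Fin n) K) _) ≤ varsSubmodule ι T' :=
  Submodule.pi_mono fun _ _ => Ideal.span_mono (Set.image_mono h)

theorem X_smul_mem_varsSubmodule {T : Set (Fin n)} {i : Fin n} (hi : i ∈ T)
    (v : ι → MvPolynomial (Fin n) K) :
    (X i : MvPolynomial (Fin n) K) • v ∈ varsSubmodule ι T := by
  simp only [varsSubmodule, Submodule.mem_pi, Set.mem_univ, true_implies, Pi.smul_apply,
    smul_eq_mul]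
  exact fun b => Ideal.mul_mem_right _ _ (Ideal.subset_span ⟨i, hi, rfl⟩)

theorem gradedComp_mem_varsSubmodule {T : Set (Fin n)} {v : ι → MvPolynomial (Fin n) K}
    (hv : v ∈ varsSubmodule ι T) (d : ι → ℕ) (e : ℕ) : gradedComp d e v ∈ varsSubmodule ι T := by
  rw [mem_varsSubmodule] at hv ⊢
  intro b a ha
  refine hv b a ?_
  rw [mem_support_iff, coeff_gradedComp] at ha
  rw [mem_support_iff]
  exact fun h => ha (by simp [h])

theorem exists_of_mem_varsSubmodule_insert {T : Set (Fin n)} {i : Fin n}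
    {v : ι → MvPolynomial (Fin n) K} (hv : v ∈ varsSubmodule ι (insert i T)) :
    ∃ f r, r ∈ varsSubmodule ι T ∧ v = (X i : MvPolynomial (Fin n) K) • f + r := by
  simp only [varsSubmodule, Submodule.mem_pi, Set.mem_univ, true_implies, Set.image_insert_eq]
    at hv
  choose f r hr h using fun b => Ideal.mem_span_insert.1 (hv b)
  refine ⟨f, r, ?_, ?_⟩
  · simpa only [varsSubmodule, Submodule.mem_pi, Set.mem_univ, true_implies] using hr
  · ext1 b
    simp [h b, mul_comm]

/-- A variable outside `T` is a nonzerodivisor modulo the variables in `T`. -/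
theorem mem_varsSubmodule_of_X_smul_mem {T : Set (Fin n)} {i : Fin n} (hi : i ∉ T)
    {v : ι → MvPolynomial (Fin n) K}
    (hv : (X i : MvPolynomial (Fin n) K) • v ∈ varsSubmodule ι T) : v ∈ varsSubmodule ι T := by
  classical
  rw [mem_varsSubmodule] at hv ⊢
  intro b a ha
  obtain ⟨t, ht, hat⟩ := hv b (Finsupp.single i 1 + a) (by
    rw [Pi.smul_apply, smul_eq_mul, mem_support_iff, coeff_X_mul]
    exact mem_support_iff.1 ha)
  refine ⟨t, ht, ?_⟩
  have hne : i ≠ t := fun h => hi (h ▸ ht)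
  simpa [hne] using hat

theorem map_mem_varsSubmodule [Fintype ι] [DecidableEq ι] {T : Set (Fin n)}
    (φ : (ι → MvPolynomial (Fin n) K) →ₗ[MvPolynomial (Fin n) K] (κ → MvPolynomial (Fin n) K))
    {v : ι → MvPolynomial (Fin n) K} (hv : v ∈ varsSubmodule ι T) :
    φ v ∈ varsSubmodule κ T := by
  simp only [varsSubmodule, Submodule.mem_pi, Set.mem_univ, true_implies] at hv ⊢
  intro c
  rw [φ.pi_apply_eq_sum_univ v, Finset.sum_apply]
  exact Ideal.sum_mem _ fun b _ => Ideal.mul_mem_right _ _ (hv b)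

/-! ### Homogeneous maps -/

section GradedMap

variable [Fintype ι] [DecidableEq ι] {dG : ι → ℕ} {dF : κ → ℕ}
  {φ : (ι → MvPolynomial (Fin n) K) →ₗ[MvPolynomial (Fin n) K] (κ → MvPolynomial (Fin n) K)}

theorem map_gradedComp (hφ : ∀ b, IsHomogeneousVec dF (dG b) (φ (Pi.single b 1))) (e : ℕ)
    (v : ι → MvPolynomial (Fin n) K) : φ (gradedComp dG e v) = gradedComp dF e (φ v) := by
  classical
  -- Both sides are `K`-linear, so monomial multiples of basis vectors suffice; these are
  -- homogeneous.
  suffices h : φ.restrictScalars K ∘ₗ gradedComp dG e = gradedComp dF e ∘ₗ φ.restrictScalars K from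
    LinearMap.congr_fun h v
  refine LinearMap.pi_ext' fun b => MvPolynomial.linearMap_ext fun a => LinearMap.ext_ring ?_
  simp only [LinearMap.comp_apply, LinearMap.restrictScalars_apply, LinearMap.single_apply]
  have h1 : IsHomogeneousVec dG (dG b + a.degree)
      (Pi.single b (monomial a (1 : K)) : ι → MvPolynomial (Fin n) K) := by
    intro b' a' ha'
    by_cases hb : b' = b
    · subst hb
      rw [Pi.single_eq_same] at ha'
      rw [Finset.mem_singleton.1 (support_monomial_subset ha')]
    · simp [Pi.single_eq_of_ne hb] at ha'
  have h2 : φ (Pi.single b (monomial a (1 : K))) = monomial a (1 : K) • φ (Pi.single b 1) := by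
    rw [← map_smul, ← Pi.single_smul, smul_eq_mul, mul_one]
  have h3 : IsHomogeneousVec dF (dG b + a.degree) (φ (Pi.single b (monomial a (1 : K)))) := by
    intro c a' ha'
    rw [h2, Pi.smul_apply, smul_eq_mul] at ha'
    obtain ⟨a₁, h₁, a₂, h₂, rfl⟩ := Finset.mem_add.1 (support_mul _ _ ha')
    rw [Finset.mem_singleton.1 (support_monomial_subset h₁)]
    have := hφ b c a₂ h₂
    rw [map_add]
    omega
  by_cases he : dG b + a.degree = e
  · subst he
    erw [h1.gradedComp_of_eq, h3.gradedComp_of_eq]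
  · erw [h1.gradedComp_of_ne he, h3.gradedComp_of_ne he, map_zero]

theorem isHomogeneousVec_map (hφ : ∀ b, IsHomogeneousVec dF (dG b) (φ (Pi.single b 1))) {e : ℕ}
    {v : ι → MvPolynomial (Fin n) K} (hv : IsHomogeneousVec dG e v) :
    IsHomogeneousVec dF e (φ v) := by
  rw [← hv.gradedComp_of_eq, map_gradedComp hφ]
  exact isHomogeneousVec_gradedComp _ _ _

end GradedMap

/-! ### Almost regular sequences and syzygies -/

/-- The variables, taken in the order given by `r`, form an almost regular sequence on `F / N`
whose defects vanish in all degrees `≥ q`. -/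
def AlmostRegularFrom (r : Fin n → ℕ) (d : ι → ℕ)
    (N : Submodule (MvPolynomial (Fin n) K) (ι → MvPolynomial (Fin n) K)) (q : ℕ) : Prop :=
  ∀ (i : Fin n) (e : ℕ) (v : ι → MvPolynomial (Fin n) K), q ≤ e → IsHomogeneousVec d e v →
    (X i : MvPolynomial (Fin n) K) • v ∈ N ⊔ varsSubmodule ι {t | r t < r i} →
    v ∈ N ⊔ varsSubmodule ι {t | r t < r i}

section Syzygy

variable [Fintype ι] [DecidableEq ι] {dG : ι → ℕ} {dF : κ → ℕ}
  {φ : (ι → MvPolynomial (Fin n) K) →ₗ[MvPolynomial (Fin n) K] (κ → MvPolynomial (Fin n) K)}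
  {r : Fin n → ℕ} {q : ℕ}

/-- This is the vanishing of `Tor₁(F/N, S/(x_t : r t < k))` in degrees above `q`, where `N` is the
range of `φ`. Write `φ g = x_i f + s` with `x_i` the last variable; almost regularity gives `f = φ w
+ s₂`, and `g - x_i w` needs one variable fewer. -/
theorem mem_ker_sup_varsSubmodule (hr : Function.Injective r)
    (hφ : ∀ b, IsHomogeneousVec dF (dG b) (φ (Pi.single b 1)))
    (hN : AlmostRegularFrom r dF (LinearMap.range φ) q) (k : ℕ) {e : ℕ} (he : q ≤ e)
    {g : ι → MvPolynomial (Fin n) K} (hg : IsHomogeneousVec dG (e + 1) g)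
    (hφg : φ g ∈ varsSubmodule κ {t | r t < k}) :
    g ∈ LinearMap.ker φ ⊔ varsSubmodule ι {t | r t < k} := by
  induction k generalizing g with
  | zero =>
    refine Submodule.mem_sup_left (LinearMap.mem_ker.2 ?_)
    have h := mem_varsSubmodule.1 hφg
    ext c a
    by_contra h0
    obtain ⟨i, hi, -⟩ := h c a (mem_support_iff.2 h0)
    exact absurd hi (Nat.not_lt_zero _)
  | succ k ih =>
    have hmono : ({t | r t < k} : Set (Fin n)) ⊆ {t | r t < k + 1} := fun t ht =>
      Nat.lt_succ_of_lt ht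
    by_cases hk : ∃ i, r i = k
    · obtain ⟨i, rfl⟩ := hk
      have hset : ({t | r t < r i + 1} : Set (Fin n)) = insert i {t | r t < r i} := by
        ext t
        simp only [Set.mem_ofPred_eq, Set.mem_insert_iff, ← hr.eq_iff (a := t)]
        omega
      rw [hset] at hφg
      obtain ⟨f, s, hs, hfs⟩ := exists_of_mem_varsSubmodule_insert hφg
      -- Taking components makes `f` homogeneous of degree `e`, where almost regularity applies.
      have hfs' : φ g = (X i : MvPolynomial (Fin n) K) • gradedComp dF e f +
          gradedComp dF (e + 1) s := by
        rw [← gradedComp_X_smul, ← map_add, ← hfs,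
          (isHomogeneousVec_map hφ hg).gradedComp_of_eq]
      have hs' := gradedComp_mem_varsSubmodule hs dF (e + 1)
      have hf : gradedComp dF e f ∈
          LinearMap.range φ ⊔ varsSubmodule κ {t | r t < r i} := by
        refine hN i e _ he (isHomogeneousVec_gradedComp _ _ _) ?_
        rw [eq_sub_of_add_eq hfs'.symm]
        exact Submodule.sub_mem _ (Submodule.mem_sup_left ⟨g, rfl⟩) (Submodule.mem_sup_right hs')
      obtain ⟨_, ⟨w, rfl⟩, s₂, hs₂, hw⟩ := Submodule.mem_sup.1 hf
      have hw' : gradedComp dF e f = φ (gradedComp dG e w) + gradedComp dF e s₂ := by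
        rw [map_gradedComp hφ, ← map_add, hw, (isHomogeneousVec_gradedComp _ _ _).gradedComp_of_eq]
      have hs₂' := gradedComp_mem_varsSubmodule hs₂ dF e
      have key := ih (g := g - (X i : MvPolynomial (Fin n) K) • gradedComp dG e w) (by
        rw [← hg.gradedComp_of_eq, ← gradedComp_X_smul, ← map_sub]
        exact isHomogeneousVec_gradedComp _ _ _) (by
        have : φ (g - (X i : MvPolynomial (Fin n) K) • gradedComp dG e w) =
            (X i : MvPolynomial (Fin n) K) • gradedComp dF e s₂ + gradedComp dF (e + 1) s := by
          rw [map_sub, map_smul, hfs', hw', smul_add]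
          abel
        rw [this]
        exact Submodule.add_mem _ (Submodule.smul_mem _ _ hs₂') hs')
      rw [← sub_add_cancel g ((X i : MvPolynomial (Fin n) K) • gradedComp dG e w)]
      exact Submodule.add_mem _ (sup_le_sup_left (varsSubmodule_mono hmono) _ key)
        (Submodule.mem_sup_right (X_smul_mem_varsSubmodule (by simp) _))
    · have hset : ({t | r t < k + 1} : Set (Fin n)) = {t | r t < k} := by
        ext t
        have : r t ≠ k := fun h => hk ⟨t, h⟩
        simp only [Set.mem_ofPred_eq]
        omega
      rw [hset] at hφg ⊢
      exact ih hg hφg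

/-- Passing to the syzygy module raises the degree bound by one. -/
theorem AlmostRegularFrom.ker (hr : Function.Injective r)
    (hφ : ∀ b, IsHomogeneousVec dF (dG b) (φ (Pi.single b 1)))
    (hN : AlmostRegularFrom r dF (LinearMap.range φ) q) :
    AlmostRegularFrom r dG (LinearMap.ker φ) (q + 1) := by
  intro i e v he hv hXv
  obtain ⟨e, rfl⟩ : ∃ e', e = e' + 1 := ⟨e - 1, by omega⟩
  refine mem_ker_sup_varsSubmodule hr hφ hN _ (by omega : q ≤ e) hv ?_
  -- `x_i φ(v)` lies in the span of the earlier variables, modulo which `x_i` is a nonzerodivisor.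
  refine mem_varsSubmodule_of_X_smul_mem (i := i) (by simp) ?_
  obtain ⟨a, ha, b, hb, hab⟩ := Submodule.mem_sup.1 hXv
  rw [← map_smul, ← hab, map_add, LinearMap.mem_ker.1 ha, zero_add]
  exact map_mem_varsSubmodule φ hb

/-- Minimal generators of the syzygy module lie in bounded degrees. -/
theorem degree_le_of_almostRegularFrom (hr : Function.Injective r)
    (hφ : ∀ b, IsHomogeneousVec dF (dG b) (φ (Pi.single b 1)))
    (hN : AlmostRegularFrom r dF (LinearMap.range φ) q) (hF : ∀ c, dF c ≤ q)
    (hmin : LinearMap.ker φ ≤ varsSubmodule ι Set.univ) (b : ι) : dG b ≤ q := by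
  classical
  by_contra hb
  obtain ⟨e, he⟩ : ∃ e, dG b = e + 1 := ⟨dG b - 1, by omega⟩
  obtain ⟨k, hk⟩ : ∃ k, ∀ t, r t < k :=
    ⟨Finset.univ.sup r + 1, fun t => Nat.lt_succ_of_le (Finset.le_sup (Finset.mem_univ t))⟩
  have hset : ({t | r t < k} : Set (Fin n)) = Set.univ := Set.eq_univ_of_forall hk
  have h1 : IsHomogeneousVec dG (e + 1) (Pi.single b 1 : ι → MvPolynomial (Fin n) K) := by
    intro b' a' ha'
    by_cases hb' : b' = b
    · subst hb'
      rw [Pi.single_eq_same] at ha'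
      rw [Finset.mem_singleton.1 (support_monomial_subset ha'), ← he]
      simp
    · simp [Pi.single_eq_of_ne hb'] at ha'
  -- As `dF c ≤ q < dG b`, the image of the basis vector has no constant terms. By minimality the
  -- basis vector itself would then have none, although its coordinate at `b` is `1`.
  have h2 := mem_ker_sup_varsSubmodule hr hφ hN k (by omega : q ≤ e) h1 (by
    rw [hset, mem_varsSubmodule]
    intro c a ha
    have h := hφ b c a ha
    have h' := hF c
    have ha0 : a ≠ 0 := by
      rintro rfl
      simp at h
      omega
    obtain ⟨i, hi⟩ := Finsupp.ne_iff.1 ha0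
    exact ⟨i, Set.mem_univ _, hi⟩)
  rw [hset, sup_eq_right.2 hmin, mem_varsSubmodule] at h2
  obtain ⟨i, -, hi⟩ := h2 b 0 (by simp)
  exact hi rfl

end Syzygy

/-! ### Degrees in a minimal resolution -/

theorem range_le_varsSubmodule {m : ℕ} {ι : Type*}
    {φ : (ι → MvPolynomial (Fin n) K) →ₗ[MvPolynomial (Fin n) K] (Fin m → MvPolynomial (Fin n) K)}
    (h : ∀ v c, φ v c ∈ Ideal.span (Set.range (X : Fin n → MvPolynomial (Fin n) K))) :
    LinearMap.range φ ≤ varsSubmodule (Fin m) Set.univ := by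
  rintro _ ⟨v, rfl⟩
  simp only [varsSubmodule, Submodule.mem_pi, Set.mem_univ, true_implies, Set.image_univ]
  exact h v

/-- If the variables form an almost regular sequence on `S / I` up to degree `q`, then all
generators in homological degree `i` of a minimal graded free resolution of `I` have degree at
most `q + i`. -/
theorem MinGradedFreeRes.deg_le {I : Ideal (MvPolynomial (Fin n) K)} (R : MinGradedFreeRes I)
    {r : Fin n → ℕ} (hr : Function.Injective r) {q : ℕ}
    (hI : AlmostRegularFrom r (fun _ : Unit => 0) (Submodule.pi Set.univ fun _ => I) q)
    (i : ℕ) (b : Fin (R.rank i)) : R.deg i b ≤ q + i := by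
  have hker : ∀ i, LinearMap.range (R.diff i) ≤ varsSubmodule _ Set.univ := fun i =>
    range_le_varsSubmodule (R.minimal i)
  suffices h : ∀ i, (∀ b, R.deg i b ≤ q + i) ∧
      AlmostRegularFrom r (R.deg i) (LinearMap.range (R.diff i)) (q + i + 1) from (h i).1 b
  intro i
  induction i with
  | zero =>
    -- The augmentation is viewed as a map to a free module of rank one with generator in degree
    -- `0`.
    let φ : (Fin (R.rank 0) → MvPolynomial (Fin n) K) →ₗ[MvPolynomial (Fin n) K]
      (Unit → MvPolynomial (Fin n) K) := LinearMap.pi fun _ => R.aug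
    have hφ : ∀ b, IsHomogeneousVec (fun _ : Unit => 0) (R.deg 0 b) (φ (Pi.single b 1)) :=
      fun b _ a ha => (zero_add _).trans (R.aug_homogeneous b a ha)
    have hrange : LinearMap.range φ = Submodule.pi Set.univ fun _ => I := by
      ext v
      simp only [LinearMap.mem_range, Submodule.mem_pi, Set.mem_univ, true_implies,
        ← R.range_aug]
      constructor
      · rintro ⟨w, rfl⟩ c
        exact ⟨w, rfl⟩
      · intro h
        obtain ⟨w, hw⟩ := h ()
        exact ⟨w, funext fun _ => hw⟩
    have hkerφ : LinearMap.ker φ = LinearMap.range (R.diff 0) := by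
      rw [← (LinearMap.exact_iff.1 R.exact_aug)]
      ext v
      simp only [LinearMap.mem_ker]
      exact ⟨fun h => congrFun h (), fun h => funext fun _ => h⟩
    rw [← hrange] at hI
    refine ⟨fun b => degree_le_of_almostRegularFrom hr hφ hI (fun _ => Nat.zero_le _)
      (hkerφ ▸ hker 0) b, ?_⟩
    rw [← hkerφ]
    exact hI.ker hr hφ
  | succ i ih =>
    have hφ : ∀ b, IsHomogeneousVec (R.deg i) (R.deg (i + 1) b) (R.diff i (Pi.single b 1)) :=
      R.diff_homogeneous i
    have hkerφ := LinearMap.exact_iff.1 (R.exact_diff i)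
    refine ⟨fun b => degree_le_of_almostRegularFrom hr hφ ih.2
      (fun c => (ih.1 c).trans (Nat.le_succ _)) (hkerφ ▸ hker (i + 1)) b, ?_⟩
    rw [← hkerφ]
    exact ih.2.ker hr hφ

/-! ### Associated primes and Borel type -/

/-- In a Noetherian ring, if every associated prime of `R / I` containing `x` contains `y`, then an
element killed modulo `I` by a power of `x` is killed modulo `I` by a power of `y`. -/
theorem mem_radical_colon_of_associatedPrimes {R : Type*} [CommRing R] [IsNoetherianRing R]
    {I : Ideal R} {x y f : R} (hxy : ∀ P ∈ associatedPrimes R (R ⧸ I), x ∈ P → y ∈ P)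
    (hx : x ∈ (I.colon {f}).radical) : y ∈ (I.colon {f}).radical := by
  -- The cyclic module generated by the class of `f` has annihilator `I : f`, so the minimal primes
  -- of `I : f` are associated to `R/I`.
  let M : Submodule R (R ⧸ I) := Submodule.span R {Ideal.Quotient.mk I f}
  have hann : Module.annihilator R M = I.colon {f} := by
    ext z
    rw [← Submodule.annihilator, Submodule.mem_annihilator_span_singleton,
      Submodule.mem_colon_singleton, smul_eq_mul, ← Ideal.Quotient.eq_zero_iff_mem, map_mul,
      Algebra.smul_def]
    rfl
  rw [← Ideal.sInf_minimalPrimes, Submodule.mem_sInf]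
  intro P hP
  refine hxy P (associatedPrimes.subset_of_injective (f := M.subtype) M.injective_subtype ?_) ?_
  · exact Module.associatedPrimes.minimalPrimes_annihilator_subset_associatedPrimes R M
      (hann ▸ hP)
  · exact (hP.1.1.radical_le_iff.2 hP.1.2) hx

/-- A finite total preorder on the indices can be sorted. -/
theorem exists_perm_of_total {n : ℕ} (s : Fin n → Fin n → Prop) (hs : ∀ i j, s i j ∨ s j i)
    (htrans : ∀ i j k, s i j → s j k → s i k) :
    ∃ σ : Equiv.Perm (Fin n), ∀ a b, a ≤ b → s (σ a) (σ b) := by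
  classical
  -- Sort by the number of predecessors: if `s (σ a) (σ b)` failed, `σ b` would have strictly fewer
  -- than `σ a`.
  let f : Fin n → ℕ := fun i => (Finset.univ.filter fun j => s j i).card
  refine ⟨Tuple.sort f, fun a b hab => ?_⟩
  by_contra h
  have hba := (hs (Tuple.sort f a) (Tuple.sort f b)).resolve_left h
  refine (Tuple.monotone_sort f hab).not_gt (Finset.card_lt_card ?_)
  refine Finset.ssubset_iff_subset_ne.2 ⟨fun j hj => ?_, fun he => h ?_⟩
  · simp only [Finset.mem_filter, Finset.mem_univ, true_and] at hj ⊢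
    exact htrans _ _ _ hj hba
  · have hrefl : Tuple.sort f a ∈ Finset.univ.filter fun j => s j (Tuple.sort f a) := by
      simpa using hs (Tuple.sort f a) (Tuple.sort f a)
    rw [← he] at hrefl
    simpa using hrefl

/-- `J` is finitely generated, so one exponent works for all of `J`. As a radical is an ideal,
membership can then be tested on generators, variable by variable. -/
theorem mem_saturation {R : Type*} [CommRing R] [IsNoetherianRing R] {I J : Ideal R} {f : R} :
    f ∈ saturation I J ↔ J ≤ (I.colon {f}).radical := by
  have hmono : Monotone fun k : ℕ => Submodule.colon I ((J ^ k : Ideal R) : Set R) :=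
    fun k l hkl => Submodule.colon_mono le_rfl (Ideal.pow_le_pow_right hkl)
  have hcolon : ∀ k : ℕ, f ∈ Submodule.colon I ((J ^ k : Ideal R) : Set R) ↔
      J ^ k ≤ I.colon {f} := by
    intro k
    rw [Submodule.mem_colon]
    refine forall₂_congr fun z _ => ?_
    rw [Submodule.mem_colon_singleton, smul_eq_mul, smul_eq_mul, mul_comm]
  rw [saturation, Submodule.mem_iSup_of_directed _ hmono.directed_le]
  simp only [hcolon]
  refine ⟨fun ⟨k, hk⟩ z hz => ⟨k, hk (Ideal.pow_mem_pow hz k)⟩, fun h => ?_⟩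
  exact Ideal.exists_pow_le_of_le_radical_of_fg h (IsNoetherian.noetherian J)

theorem isBorelType_iff {I : Ideal (MvPolynomial (Fin n) K)} :
    IsBorelType I ↔ ∀ i j : Fin n, i ≤ j → ∀ f : MvPolynomial (Fin n) K,
      X j ∈ (I.colon {f}).radical → X i ∈ (I.colon {f}).radical := by
  simp only [IsBorelType, SetLike.ext_iff, mem_saturation, Ideal.span_le, Set.subset_def,
    Set.mem_singleton_iff, forall_eq, Set.forall_mem_image, Set.mem_ofPred_eq, SetLike.mem_coe]
  exact ⟨fun h i j hij f hf => (h j f).1 hf hij,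
    fun h j f => ⟨fun hf i hij => h i j hij f hf, fun hf => hf le_rfl⟩⟩

/-- Borel type after renaming the variables, expressed for the original ideal. -/
theorem isBorelType_map_rename {I : Ideal (MvPolynomial (Fin n) K)} {σ : Equiv.Perm (Fin n)}
    (h : ∀ a b, a ≤ b → ∀ f : MvPolynomial (Fin n) K,
      X (σ b) ∈ (I.colon {f}).radical → X (σ a) ∈ (I.colon {f}).radical) :
    IsBorelType (I.map (rename σ.symm : _ →ₐ[K] MvPolynomial (Fin n) K)) := by
  rw [isBorelType_iff]
  have hmem : ∀ p : MvPolynomial (Fin n) K,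
      p ∈ I.map (rename σ.symm : _ →ₐ[K] MvPolynomial (Fin n) K) ↔ rename σ p ∈ I := by
    intro p
    have := Ideal.mem_map_of_equiv (renameEquiv K σ.symm) (I := I) p
    constructor
    · intro hp
      obtain ⟨z, hz, rfl⟩ := this.1 hp
      simpa [rename_rename] using hz
    · intro hp
      exact this.2 ⟨_, hp, by simp [rename_rename]⟩
  have hrad : ∀ (j : Fin n) (f : MvPolynomial (Fin n) K),
      X j ∈ ((I.map (rename σ.symm : _ →ₐ[K] MvPolynomial (Fin n) K)).colon {f}).radical ↔
      X (σ j) ∈ (I.colon {rename σ f}).radical := by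
    intro j f
    simp only [Ideal.mem_radical_iff, Submodule.mem_colon_singleton, smul_eq_mul, hmem, map_mul,
      map_pow, rename_X]
  intro i j hij f
  rw [hrad, hrad]
  exact h i j hij _

/-! ### Monomial ideals and the degree bound -/

variable {I : Ideal (MvPolynomial (Fin n) K)}

theorem exists_minGens_le {a : Fin n →₀ ℕ} (ha : monomial a (1 : K) ∈ I) :
    ∃ g ∈ minGens I, g ≤ a := by
  obtain ⟨g, hg, hmin⟩ := exists_minimal_le_of_wellFoundedLT
    (fun b : Fin n →₀ ℕ => monomial b (1 : K) ∈ I) a ha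
  exact ⟨g, hmin, hg⟩

theorem monomial_mem_of_mem_minGens {g : Fin n →₀ ℕ} (hg : g ∈ minGens I) :
    monomial g (1 : K) ∈ I :=
  Minimal.prop (P := fun b : Fin n →₀ ℕ => monomial b (1 : K) ∈ I) hg

theorem monomial_mem_of_le {a g : Fin n →₀ ℕ} (hg : monomial g (1 : K) ∈ I) (h : g ≤ a) :
    monomial a (1 : K) ∈ I := by
  rw [← tsub_add_cancel_of_le h, ← one_mul (1 : K), ← monomial_mul]
  exact Ideal.mul_mem_left _ _ hg

theorem IsMonomialIdeal.eq_span_minGens (hI : IsMonomialIdeal I) :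
    I = Ideal.span ((fun a => monomial a (1 : K)) '' minGens I) := by
  apply le_antisymm
  · obtain ⟨A, hA⟩ := hI
    conv_lhs => rw [hA]
    rw [Ideal.span_le]
    rintro _ ⟨a, ha, rfl⟩
    obtain ⟨g, hg, hga⟩ := exists_minGens_le (I := I) (a := a)
      (hA ▸ Ideal.subset_span ⟨a, ha, rfl⟩)
    exact monomial_mem_of_le (Ideal.subset_span ⟨g, hg, rfl⟩) hga
  · rw [Ideal.span_le]
    rintro _ ⟨a, ha, rfl⟩
    exact monomial_mem_of_mem_minGens ha

theorem degree_le_genDeg {g : Fin n →₀ ℕ} (hg : g ∈ minGens I) : g.degree ≤ genDeg I :=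
  Finset.le_sup (f := fun a : Fin n →₀ ℕ => a.degree) ((minGens_finite I).mem_toFinset.2 hg)

theorem lt_maxVarIdeal {g : Fin n →₀ ℕ} (hg : g ∈ minGens I) {j : Fin n} (hj : g j ≠ 0) :
    (j : ℕ) < maxVarIdeal I :=
  (Finset.le_sup (f := fun i : Fin n => (i : ℕ) + 1) (Finsupp.mem_support_iff.2 hj)).trans
    (Finset.le_sup (f := maxVar) ((minGens_finite I).mem_toFinset.2 hg))

/-- When `deg(I) = 0`, `deg(I) - 1` is `0` in `ℕ` but `-1` in `ℤ`; the factor `m(I) = 0` makes the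
two bounds agree. -/
theorem maxVarIdeal_eq_zero_of_genDeg_eq_zero (h : genDeg I = 0) : maxVarIdeal I = 0 := by
  refine Nat.eq_zero_of_le_zero (Finset.sup_le fun g hg => ?_)
  have h0 := degree_le_genDeg ((minGens_finite I).mem_toFinset.1 hg)
  rw [h, Nat.le_zero, Finsupp.degree_eq_zero_iff] at h0
  simp [h0, maxVar]

/-- If a monomial outside `I` is moved into `I` by a power of `x_j`, then a minimal generator of
`I` has a larger exponent at `x_j`. -/
theorem exists_minGens_lt {a : Fin n →₀ ℕ} (ha : monomial a (1 : K) ∉ I) {j : Fin n}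
    (hj : X j ∈ (I.colon {monomial a (1 : K)}).radical) : ∃ g ∈ minGens I, a j < g j := by
  obtain ⟨N, hN⟩ := hj
  rw [Submodule.mem_colon_singleton, smul_eq_mul, X_pow_eq_monomial, monomial_mul, one_mul] at hN
  obtain ⟨g, hg, hle⟩ := exists_minGens_le hN
  refine ⟨g, hg, ?_⟩
  by_contra! hlt
  refine ha (monomial_mem_of_le (monomial_mem_of_mem_minGens hg) fun t => ?_)
  by_cases ht : t = j
  · exact ht ▸ hlt
  · simpa [Finsupp.single_eq_of_ne ht] using hle t

/-- For an ideal of Borel type with respect to the order given by `r`, the variables form an almost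
regular sequence on `S / I`, with defects in degrees at most `m(I) (deg(I) - 1)`. -/
theorem IsMonomialIdeal.almostRegularFrom (hI : IsMonomialIdeal I) {r : Fin n → ℕ}
    (hr : ∀ i j, r i ≤ r j → ∀ f : MvPolynomial (Fin n) K,
      X i ∈ (I.colon {f}).radical → X j ∈ (I.colon {f}).radical) :
    AlmostRegularFrom r (fun _ : Unit => 0) (Submodule.pi Set.univ fun _ => I)
      (maxVarIdeal I * (genDeg I - 1) + 1) := by
  classical
  intro i e v he hv hXv
  -- `I` plus the earlier variables is a monomial ideal, so membership is tested monomial by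
  -- monomial.
  have hmem : ∀ w : Unit → MvPolynomial (Fin n) K,
      w ∈ (Submodule.pi Set.univ fun _ => I) ⊔ varsSubmodule Unit {t | r t < r i} ↔
      ∀ a ∈ (w ()).support, ∃ g ∈ minGens I ∪ (fun t => Finsupp.single t 1) '' {t | r t < r i},
        g ≤ a := by
    intro w
    rw [← mem_ideal_span_monomial_image (R := K), Set.image_union, Ideal.span_union,
      ← hI.eq_span_minGens, Set.image_image]
    constructor
    · intro h
      obtain ⟨p, hp, s, hs, rfl⟩ := Submodule.mem_sup.1 h
      exact Submodule.add_mem_sup (Submodule.mem_pi.1 hp () trivial)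
        (Submodule.mem_pi.1 hs () trivial)
    · intro h
      obtain ⟨p, hp, s, hs, hps⟩ := Submodule.mem_sup.1 h
      exact Submodule.mem_sup.2 ⟨fun _ => p, Submodule.mem_pi.2 fun _ _ => hp, fun _ => s,
        Submodule.mem_pi.2 fun _ _ => hs, funext fun _ => hps⟩
  rw [hmem] at hXv ⊢
  intro a ha
  by_cases hT : ∃ t, r t < r i ∧ a t ≠ 0
  · obtain ⟨t, ht, hat⟩ := hT
    exact ⟨_, Or.inr ⟨t, ht, rfl⟩, Finsupp.single_le_iff.2 (Nat.one_le_iff_ne_zero.2 hat)⟩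
  by_cases haI : monomial a (1 : K) ∈ I
  · obtain ⟨g, hg, hga⟩ := exists_minGens_le haI
    exact ⟨g, Or.inl hg, hga⟩
  exfalso
  push Not at hT
  have hXi : X i ∈ (I.colon {monomial a (1 : K)}).radical := by
    refine Ideal.le_radical ?_
    obtain ⟨g, hg | ⟨t, ht, rfl⟩, hga⟩ := hXv (Finsupp.single i 1 + a) (by
      rw [Pi.smul_apply, smul_eq_mul, mem_support_iff, coeff_X_mul]
      exact mem_support_iff.1 ha)
    · rw [Submodule.mem_colon_singleton, smul_eq_mul, X, monomial_mul, one_mul]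
      exact monomial_mem_of_le (monomial_mem_of_mem_minGens hg) hga
    · have h1 := Finsupp.single_le_iff.1 hga
      have hti : t ≠ i := fun h => absurd (h ▸ ht : r i < r i) (lt_irrefl _)
      rw [Finsupp.add_apply, Finsupp.single_eq_of_ne hti, hT t ht] at h1
      omega
  let U : Finset (Fin n) := Finset.univ.filter fun j => r i ≤ r j
  have hU : ∀ j ∈ U, ∃ g ∈ minGens I, a j < g j := fun j hj =>
    exists_minGens_lt haI (hr i j (by simpa [U] using hj) _ hXi)
  -- Each variable in `U` divides a minimal generator, so its original index is below `m(I)`,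
  -- whatever the order `r`.
  have hcard : U.card ≤ maxVarIdeal I := by
    have h := Finset.card_le_card_of_injOn (s := U) (t := Finset.range (maxVarIdeal I))
      (fun j => (j : ℕ)) (fun j hj => by
        obtain ⟨g, hg, hlt⟩ := hU j hj
        simpa using lt_maxVarIdeal hg (Nat.ne_zero_of_lt hlt)) (Fin.val_injective.injOn)
    simpa using h
  have hdeg : a.degree ≤ U.card * (genDeg I - 1) := by
    rw [Finsupp.degree_eq_sum, ← Finset.sum_subset (Finset.subset_univ U) (fun j _ hj => hT j (by
      simpa [U] using hj)), ← smul_eq_mul]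
    refine Finset.sum_le_card_nsmul _ _ _ fun j hj => ?_
    obtain ⟨g, hg, hlt⟩ := hU j hj
    have h1 := degree_le_genDeg hg
    have h2 := Finsupp.le_degree j g
    omega
  have h1 : 0 + a.degree = e := hv () a ha
  have h2 := Nat.mul_le_mul_right (genDeg I - 1) hcard
  omega

/-! ### Regularity and the conclusion -/

theorem regularity_le_of_almostRegularFrom {r : Fin n → ℕ} (hr : Function.Injective r) {q : ℕ}
    (hI : AlmostRegularFrom r (fun _ : Unit => 0) (Submodule.pi Set.univ fun _ => I) q) :
    regularity I ≤ (((q : ℤ) : WithTop ℤ) : WithBot (WithTop ℤ)) := by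
  refine sSup_le ?_
  rintro _ ⟨i, j, hij, rfl⟩
  rw [gradedBetti] at hij
  -- Without a resolution the Betti numbers default to `0` and contribute nothing.
  split_ifs at hij with h
  · obtain ⟨b, hb⟩ := Finset.card_ne_zero.1 hij
    have hdeg := h.some.deg_le hr hI i b
    rw [(Finset.mem_filter.1 hb).2] at hdeg
    rw [WithBot.coe_le_coe, WithTop.coe_le_coe]
    omega
  · exact absurd rfl hij

end

end BorelReg

theorem corollary2p5 {K : Type*} [Field K] {n : ℕ} (I : Ideal (MvPolynomial (Fin n) K))
    (hI : BorelReg.IsMonomialIdeal I)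
    (hAss : IsChain (· ≤ ·)
      (associatedPrimes (MvPolynomial (Fin n) K) (MvPolynomial (Fin n) K ⧸ I))) :
    (∃ σ : Equiv.Perm (Fin n),
      BorelReg.IsBorelType (I.map (MvPolynomial.rename σ : _ →ₐ[K] MvPolynomial (Fin n) K))) ∧
    BorelReg.regularity I ≤
      ((((BorelReg.maxVarIdeal I : ℤ) * ((BorelReg.genDeg I : ℤ) - 1) + 1 : ℤ) : WithTop ℤ) :
        WithBot (WithTop ℤ)) := by
  obtain ⟨σ, hσ⟩ := BorelReg.exists_perm_of_total
    (fun i j : Fin n => ∀ P ∈ associatedPrimes (MvPolynomial (Fin n) K)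
      (MvPolynomial (Fin n) K ⧸ I), X j ∈ P → X i ∈ P)
    -- Two variables incomparable in the preorder would give two incomparable associated primes.
    (fun i j => by
      by_contra! h
      obtain ⟨⟨P, hP, hPj, hPi⟩, Q, hQ, hQi, hQj⟩ := h
      rcases hAss.total hP hQ with hPQ | hQP
      · exact hQj (hPQ hPj)
      · exact hPi (hQP hQi))
    (fun i j k hij hjk P hP hk => hij P hP (hjk P hP hk))
  have hBorel : ∀ a b, a ≤ b → ∀ f : MvPolynomial (Fin n) K,
      X (σ b) ∈ (I.colon {f}).radical → X (σ a) ∈ (I.colon {f}).radical := fun a b hab f =>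
    BorelReg.mem_radical_colon_of_associatedPrimes (hσ a b hab)
  refine ⟨⟨σ.symm, BorelReg.isBorelType_map_rename hBorel⟩, ?_⟩
  have hreg := BorelReg.regularity_le_of_almostRegularFrom
    -- The reversal starts the almost regular sequence with the last variable of the Borel order.
    (r := fun i => ((σ.symm i).rev : ℕ))
    (fun i j h => σ.symm.injective (Fin.rev_injective (Fin.val_injective h)))
    (hI.almostRegularFrom fun i j hij f => by
      simpa using hBorel (σ.symm j) (σ.symm i) (Fin.rev_le_rev.1 hij) f)
  refine hreg.trans (le_of_eq ?_)
  congr 2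
  rcases Nat.eq_zero_or_pos (BorelReg.genDeg I) with h0 | hpos
  · simp [h0, BorelReg.maxVarIdeal_eq_zero_of_genDeg_eq_zero h0]
  · push_cast [Nat.cast_sub (Nat.succ_le_of_lt hpos)]
    simp
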